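/- Let $(X,d)$ and $(Y,\rho)$ be complete metric spaces, let $s>0$, and let $\mathcal H^s$ denote the $s$-dimensional Hausdorff (outer) measure. Let $f\colon X\to Y$ be Lipschitz and suppose $\mathcal H^s(X)<\infty$. Write $B(\cdot,r)$ for open balls of radius $r$, and for $y\in Y$ let $$\Theta^s_*(Y,y)=\liminf_{r\downarrow 0}\frac{\mathcal H^s(B(y,r))}{(2r)^s}\in[0,\infty].$$ Suppose that for $\mathcal H^s$-a.e. $x\in X$ there is $0<\lambda_x\le 1$ such that $$\limsup_{r\downarrow 0}\frac{\mathcal H^s\big(B(f(x),\lambda_x r)\setminus f(B(x,r))\big)}{(2\lambda_x r)^s}<\frac12\,\Theta^s_*(Y,f(x)).$$ Then there are pairwise disjoint Borel sets $N, X_1, X_2,\dots\subset X$ (countably many, some possibly empty) with $X=N\cup\bigcup_i X_i$ and $\mathcal H^s(N)=0$ such that each restriction $f|_{X_i}$ is bi-Lipschitz, that is, it is injective and Lipschitz and its inverse $f(X_i)\to X_i$ is Lipschitz. -/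

import Mathlib

open Set Filter Topology MeasureTheory
open scoped NNReal ENNReal MeasureTheory

/-- The lower `s`-dimensional density of the set `S` at the point `y`:
the lower limit of `H^s(B(y, r) ∩ S) / (2 r)^s` as `r` decreases to `0`.
It takes values in `[0, ∞]`; balls are open. -/
noncomputable def lowerHausdorffDensity {Y : Type*} [MetricSpace Y] [MeasurableSpace Y]
    [BorelSpace Y] (s : ℝ) (S : Set Y) (y : Y) : ℝ≥0∞ :=
  liminf (fun r : ℝ => μH[s] (Metric.ball y r ∩ S) / ENNReal.ofReal (2 * r) ^ s) (𝓝[>] 0)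

/-- The upper limit of `H^s(B(f x, l r) \ f(B(x, r))) / (2 l r)^s` as `r` decreases to `0`:
the upper `s`-density of the part of the balls `B(f x, l r)` missed by the images
`f(B(x, r))`.  (`μH[s]` of a set that is not measurable is its outer measure.) -/
noncomputable def upperMissedDensity {X Y : Type*} [MetricSpace X] [MetricSpace Y]
    [MeasurableSpace Y] [BorelSpace Y] (s : ℝ) (f : X → Y) (x : X) (l : ℝ) : ℝ≥0∞ :=
  limsup (fun r : ℝ =>
    μH[s] (Metric.ball (f x) (l * r) \ f '' Metric.ball x r) / ENNReal.ofReal (2 * l * r) ^ s)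
    (𝓝[>] 0)

/-- A map is bi-Lipschitz if it is injective and Lipschitz and its inverse, defined on its range,
is Lipschitz (the last condition is `AntilipschitzWith`). -/
def IsBiLipschitz {A B : Type*} [MetricSpace A] [MetricSpace B] (g : A → B) : Prop :=
  Function.Injective g ∧ (∃ L : ℝ≥0, LipschitzWith L g) ∧ ∃ K : ℝ≥0, AntilipschitzWith K g

/-! The constant 1/2 forces overlaps. Near a typical `x` the image of `B(x, r)` misses at most `q
r^s` of `B(f x, p r)`, while `B(f x, p' r)` has measure at least `q' r^s`, with `p' < p` and `2q <
q'`. If two such points are at distance `2r` but their images are closer than `(p - p') r`, then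
`B(f x, p' r)` lies in both target balls, so the images of two disjoint balls share positive
measure. On a set `E` where `f` is injective this is impossible near density points of `E`: the
overlap comes from points outside `E`, whose images are small because `f` is Lipschitz
(`mul_le_dist_of_mem_imageDensityPoints`).

Injective pieces come from finite fibres. A counting argument makes the fibre over almost every `y`
finite, and the density condition makes preimages of null sets null, so almost every `x` lies in a
finite fibre and is isolated in it. -/

/-! ### Covering and density for Hausdorff measure. -/

/-- A metric space of finite Hausdorff measure is second countable. -/
theorem secondCountableTopology_of_hausdorffMeasure_univ_lt_top {X : Type*} [MetricSpace X]
    [MeasurableSpace X] [BorelSpace X] {s : ℝ} (h : μH[s] (univ : Set X) < ∞) :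
    SecondCountableTopology X := by
  refine Metric.secondCountable_of_almost_dense_set fun ε hε => ?_
  rw [Measure.hausdorffMeasure_apply] at h
  -- Finiteness gives one countable cover of mesh at most `ε`; a point from each nonempty piece
  -- forms an `ε`-net.
  have h1 := (le_iSup₂ (f := fun (r : ℝ≥0∞) (_ : 0 < r) =>
    ⨅ (t : ℕ → Set X) (_ : univ ⊆ ⋃ n, t n) (_ : ∀ n, Metric.ediam (t n) ≤ r),
      ∑' n, ⨆ _ : (t n).Nonempty, Metric.ediam (t n) ^ s) (ENNReal.ofReal ε)
      (by simpa using hε)).trans_lt h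
  simp only [iInf_lt_iff] at h1
  obtain ⟨t, ht, hd, -⟩ := h1
  refine ⟨range fun n : {n // (t n).Nonempty} => n.2.some, countable_range _, fun x => ?_⟩
  obtain ⟨n, hn⟩ := mem_iUnion.1 (ht (mem_univ x))
  refine ⟨_, ⟨⟨n, ⟨x, hn⟩⟩, rfl⟩, ?_⟩
  have h2 := (Metric.edist_le_ediam_of_mem hn (Set.Nonempty.some_mem ⟨x, hn⟩)).trans (hd n)
  rw [edist_dist] at h2
  exact (ENNReal.ofReal_le_ofReal_iff hε.le).1 h2

/-- If a measure `ν` has upper `s`-density larger than `t` at all points of a subset `S` of an open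
set `U`, then `ν U` controls the Hausdorff measure of `S`. -/
theorem hausdorffMeasure_le_of_frequently_lt_measure_ball {X : Type*} [MetricSpace X]
    [SecondCountableTopology X] [MeasurableSpace X] [BorelSpace X] {s : ℝ} (hs : 0 < s)
    (ν : Measure X) {U S : Set X} (hU : IsOpen U) (hSU : S ⊆ U) {t : ℝ≥0∞} (ht : t ≠ 0)
    (ht' : t ≠ ∞)
    (h : ∀ x ∈ S, ∃ᶠ r in 𝓝[>] (0 : ℝ), t * ENNReal.ofReal r ^ s < ν (Metric.ball x r)) :
    μH[s] S ≤ 10 ^ s * ν U / t := by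
  let T : ℕ → Set (X × ℝ) := fun n => {p | p.1 ∈ S ∧ 0 < p.2 ∧ p.2 < 1 / ((n : ℝ) + 1) ∧
    Metric.closedBall p.1 p.2 ⊆ U ∧ t * ENNReal.ofReal p.2 ^ s < ν (Metric.ball p.1 p.2)}
  -- Enlarging by 5 gives balls of diameter at most `10 r`, hence the factor `10 ^ s`.
  have hV := fun n => Vitali.exists_disjoint_subfamily_covering_enlargement_closedBall (T n)
    Prod.fst Prod.snd (1 / ((n : ℝ) + 1)) (fun a ha => ha.2.2.1.le) 5 (by norm_num)
  choose u huT hdisj hcov using hV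
  have hcount : ∀ n, (u n).Countable := fun n =>
    (hdisj n).countable_of_nonempty_interior fun a ha =>
      ⟨a.1, Metric.ball_subset_interior_closedBall (Metric.mem_ball_self (huT n ha).2.1)⟩
  have : ∀ n, Countable (u n) := fun n => (hcount n).to_subtype
  have hlim : Tendsto (fun n : ℕ => ENNReal.ofReal (10 * (1 / ((n : ℝ) + 1)))) atTop (𝓝 0) := by
    have := (tendsto_one_div_add_atTop_nhds_zero_nat (𝕜 := ℝ)).const_mul 10
    simpa using ENNReal.tendsto_ofReal this
  have hdiam : ∀ (x : X) (r : ℝ), 0 < r →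
      Metric.ediam (Metric.closedBall x (5 * r)) ≤ 10 * ENNReal.ofReal r := by
    intro x r hr
    refine Metric.ediam_le fun a ha b hb => ?_
    rw [edist_dist, show (10 : ℝ≥0∞) = ENNReal.ofReal 10 by simp,
      ← ENNReal.ofReal_mul (by norm_num)]
    refine ENNReal.ofReal_le_ofReal ?_
    have := dist_triangle_right a b x
    rw [Metric.mem_closedBall] at ha hb
    linarith
  refine (Measure.hausdorffMeasure_le_liminf_tsum s S _ hlim
    (fun n (i : u n) => Metric.closedBall i.1.1 (5 * i.1.2)) ?_ ?_).trans ?_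
  · refine Eventually.of_forall fun n i => (hdiam _ _ (huT n i.2).2.1).trans ?_
    rw [ENNReal.ofReal_mul (by norm_num)]
    simp only [ENNReal.ofReal_ofNat]
    gcongr
    exact (huT n i.2).2.2.1.le
  · refine Eventually.of_forall fun n x hx => ?_
    have h1 : ∀ᶠ r in 𝓝[>] (0 : ℝ), 0 < r ∧ r < 1 / ((n : ℝ) + 1) ∧ Metric.closedBall x r ⊆ U := by
      obtain ⟨ε, hε, hεU⟩ := Metric.isOpen_iff.1 hU x (hSU hx)
      filter_upwards [Ioo_mem_nhdsGT (show (0 : ℝ) < min ε (1 / ((n : ℝ) + 1)) by positivity)]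
        with r hr
      exact ⟨hr.1, hr.2.trans_le (min_le_right _ _),
        (Metric.closedBall_subset_ball (hr.2.trans_le (min_le_left _ _))).trans hεU⟩
    obtain ⟨r, hr, hr1, hr2, hr3⟩ := ((h x hx).and_eventually h1).exists
    obtain ⟨b, hb, hsub⟩ := hcov n (x, r) ⟨hx, hr1, hr2, hr3, hr⟩
    exact mem_iUnion.2 ⟨⟨b, hb⟩, hsub (Metric.mem_closedBall_self hr1.le)⟩
  · have key : ∀ n, ∑' i : u n, Metric.ediam (Metric.closedBall i.1.1 (5 * i.1.2)) ^ s ≤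
        10 ^ s * ν U / t := by
      intro n
      rw [ENNReal.le_div_iff_mul_le (Or.inl ht) (Or.inl ht'), ← ENNReal.tsum_mul_right]
      calc ∑' i : u n, Metric.ediam (Metric.closedBall i.1.1 (5 * i.1.2)) ^ s * t
          ≤ ∑' i : u n, 10 ^ s * ν (Metric.closedBall i.1.1 i.1.2) := by
            refine ENNReal.tsum_le_tsum fun i => ?_
            calc Metric.ediam (Metric.closedBall i.1.1 (5 * i.1.2)) ^ s * t
                ≤ (10 * ENNReal.ofReal i.1.2) ^ s * t := by
                  gcongr
                  exact hdiam _ _ (huT n i.2).2.1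
              _ = 10 ^ s * (t * ENNReal.ofReal i.1.2 ^ s) := by
                  rw [ENNReal.mul_rpow_of_nonneg _ _ hs.le]; ring
              _ ≤ 10 ^ s * ν (Metric.closedBall i.1.1 i.1.2) := by
                  gcongr
                  exact (huT n i.2).2.2.2.2.le.trans (measure_mono Metric.ball_subset_closedBall)
        _ = 10 ^ s * ν (⋃ i : u n, Metric.closedBall i.1.1 i.1.2) := by
            rw [ENNReal.tsum_mul_left, measure_iUnion]
            · intro i j hij
              exact hdisj n i.2 j.2 (fun h => hij (Subtype.ext h))
            · exact fun i => Metric.isClosed_closedBall.measurableSet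
        _ ≤ 10 ^ s * ν U := by
            gcongr
            exact iUnion_subset fun i => (huT n i.2).2.2.2.1
    exact (liminf_le_liminf (Eventually.of_forall key)).trans (by simp)

/-- A measurable set of finite Hausdorff measure has density zero at almost every point outside
it. -/
theorem ae_eventually_hausdorffMeasure_ball_inter_le {X : Type*} [MetricSpace X]
    [SecondCountableTopology X] [MeasurableSpace X] [BorelSpace X] {s : ℝ} (hs : 0 < s)
    (hfin : μH[s] (univ : Set X) < ∞) {A : Set X} (hA : MeasurableSet A) :
    ∀ᵐ x ∂(μH[s] : Measure X), x ∉ A → ∀ t : ℝ≥0∞, t ≠ 0 →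
      ∀ᶠ r in 𝓝[>] (0 : ℝ), μH[s] (Metric.ball x r ∩ A) ≤ t * ENNReal.ofReal r ^ s := by
  have : IsFiniteMeasure (μH[s] : Measure X) := ⟨hfin⟩
  have hk : ∀ k : ℕ, ∀ᵐ x ∂(μH[s] : Measure X), x ∉ A →
      ∀ᶠ r in 𝓝[>] (0 : ℝ), μH[s] (Metric.ball x r ∩ A) ≤
        ((k : ℝ≥0∞) + 1)⁻¹ * ENNReal.ofReal r ^ s := by
    intro k
    rw [ae_iff]
    have hk0 : ((k : ℝ≥0∞) + 1)⁻¹ ≠ 0 := by simp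
    have hk1 : ((k : ℝ≥0∞) + 1)⁻¹ ≠ ∞ := by simp
    have hc : (10 : ℝ≥0∞) ^ s / ((k : ℝ≥0∞) + 1)⁻¹ ≠ ∞ :=
      ENNReal.div_ne_top (ENNReal.rpow_ne_top_of_nonneg hs.le (by simp)) hk0
    refine le_antisymm (ENNReal.le_of_forall_pos_le_add fun ε hε _ => ?_) zero_le
    obtain ⟨δ, hδ, hδε⟩ : ∃ δ : ℝ≥0∞, δ ≠ 0 ∧ (10 : ℝ≥0∞) ^ s / ((k : ℝ≥0∞) + 1)⁻¹ * δ ≤ ε := by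
      refine ⟨ε / (10 ^ s / ((k : ℝ≥0∞) + 1)⁻¹), ?_, ENNReal.mul_div_le⟩
      exact ENNReal.div_ne_zero.2 ⟨by simpa using hε.ne', hc⟩
    -- The covering bound is applied to `μH[s]` restricted to `A` on the open set `Cᶜ`, which has
    -- mass only `μH[s] (A \ C) < δ`.
    obtain ⟨C, hCA, hC, hlt⟩ := hA.exists_isClosed_sdiff_lt (measure_ne_top μH[s] A) hδ
    refine (hausdorffMeasure_le_of_frequently_lt_measure_ball hs (μH[s].restrict A) hC.isOpen_compl
      (t := ((k : ℝ≥0∞) + 1)⁻¹) ?_ hk0 hk1 ?_).trans ?_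
    · intro x hx hxC
      exact hx fun h => absurd (hCA hxC) h
    · intro x hx
      simp only [mem_ofPred_eq, Classical.not_imp, not_eventually, not_le] at hx
      refine hx.2.mono fun r hr => ?_
      rwa [Measure.restrict_apply Metric.isOpen_ball.measurableSet]
    · rw [Measure.restrict_apply hC.isOpen_compl.measurableSet, zero_add]
      refine le_trans ?_ hδε
      rw [mul_comm (_ / _), ← mul_div_assoc, mul_comm δ]
      gcongr
      rw [inter_comm, ← sdiff_eq]
      exact hlt.le
  filter_upwards [ae_all_iff.2 hk] with x hx hxA t ht
  obtain ⟨k, hk⟩ := ENNReal.exists_inv_nat_lt ht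
  filter_upwards [hx k hxA] with r hr
  refine hr.trans ?_
  gcongr
  exact (ENNReal.inv_le_inv.2 (by simp)).trans hk.le

/-! ### Finiteness of almost every fibre. -/

theorem ENNReal.tendsto_inv_nat_add_one_nhds_zero :
    Tendsto (fun k : ℕ => ((k : ℝ≥0∞) + 1)⁻¹) atTop (𝓝 0) := by
  simpa using (tendsto_add_atTop_iff_nat 1).2 ENNReal.tendsto_inv_nat_nhds_zero

theorem ENNReal.exists_nat_add_mul_inv_lt {a b c : ℝ≥0∞} (hab : a < b) (hc : c ≠ ∞) :
    ∃ k : ℕ, a + c * ((k : ℝ≥0∞) + 1)⁻¹ < b := by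
  have h : Tendsto (fun k : ℕ => a + c * ((k : ℝ≥0∞) + 1)⁻¹) atTop (𝓝 (a + c * 0)) :=
    (ENNReal.Tendsto.const_mul ENNReal.tendsto_inv_nat_add_one_nhds_zero (Or.inr hc)).const_add a
  rw [mul_zero, add_zero] at h
  exact (h.eventually (gt_mem_nhds hab)).exists

theorem exists_measurable_partition_dist_lt (X : Type*) [MetricSpace X]
    [SecondCountableTopology X] [MeasurableSpace X] [BorelSpace X] {δ : ℝ} (hδ : 0 < δ) :
    ∃ U : ℕ → Set X, (∀ i, MeasurableSet (U i)) ∧ Pairwise (Function.onFun Disjoint U) ∧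
      ⋃ i, U i = univ ∧ ∀ i, ∀ x ∈ U i, ∀ y ∈ U i, dist x y < δ := by
  rcases isEmpty_or_nonempty X with hX | hX
  · exact ⟨fun _ => ∅, fun _ => MeasurableSet.empty, fun _ _ _ => disjoint_bot_left,
      Subsingleton.elim _ _, fun _ x => hX.elim x⟩
  · refine ⟨disjointed fun i => Metric.ball (TopologicalSpace.denseSeq X i) (δ / 2),
      fun i => MeasurableSet.disjointed (fun _ => Metric.isOpen_ball.measurableSet) i,
      disjoint_disjointed _, ?_, fun i x hx y hy => ?_⟩
    · rw [iUnion_disjointed, eq_univ_iff_forall]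
      intro x
      obtain ⟨i, hi⟩ := (TopologicalSpace.denseRange_denseSeq X).exists_dist_lt x (half_pos hδ)
      exact mem_iUnion.2 ⟨i, hi⟩
    · have h1 := disjointed_subset _ i hx
      have h2 := disjointed_subset _ i hy
      rw [Metric.mem_ball] at h1 h2
      linarith [dist_triangle_right x y (TopologicalSpace.denseSeq X i)]

/-- Almost every fibre of a Lipschitz map on a space of finite Hausdorff measure is finite. -/
theorem LipschitzWith.ae_finite_preimage_singleton {X Y : Type*} [MetricSpace X]
    [SecondCountableTopology X] [MeasurableSpace X] [BorelSpace X] [MetricSpace Y]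
    [MeasurableSpace Y] [BorelSpace Y] {s : ℝ} (hs : 0 ≤ s) {f : X → Y} {L : ℝ≥0}
    (hf : LipschitzWith L f) (hfin : μH[s] (univ : Set X) < ∞) :
    ∀ᵐ y ∂(μH[s] : Measure Y), (f ⁻¹' {y}).Finite := by
  have hU := fun n : ℕ =>
    exists_measurable_partition_dist_lt X (Nat.one_div_pos_of_nat (α := ℝ) (n := n))
  choose U hUm hUd hUc hUs using hU
  -- `g n` bounds from above the number of pieces of mesh `1 / (n + 1)` meeting the fibre;
  -- measurable hulls are used as the images need not be measurable. The integrals are uniformly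
  -- bounded, so Fatou applies, while `M` points of a fibre eventually lie in distinct pieces.
  let g : ℕ → Y → ℝ≥0∞ := fun n y =>
    ∑' i, (toMeasurable μH[s] (f '' U n i)).indicator (fun _ => 1) y
  have hgm : ∀ n, Measurable (g n) := fun n => Measurable.tsum fun i =>
    measurable_const.indicator (measurableSet_toMeasurable _ _)
  have hgi : ∀ n, ∫⁻ y, g n y ∂μH[s] ≤ (L : ℝ≥0∞) ^ s * μH[s] (univ : Set X) := by
    intro n
    rw [lintegral_tsum fun i =>
      (measurable_const.indicator (measurableSet_toMeasurable _ _)).aemeasurable]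
    calc ∑' i, ∫⁻ y, (toMeasurable μH[s] (f '' U n i)).indicator (fun _ => 1) y ∂μH[s]
        = ∑' i, μH[s] (f '' U n i) := by
          congr with i
          rw [lintegral_indicator_const (measurableSet_toMeasurable _ _), one_mul,
            measure_toMeasurable]
      _ ≤ ∑' i, (L : ℝ≥0∞) ^ s * μH[s] (U n i) :=
          ENNReal.tsum_le_tsum fun i => hf.hausdorffMeasure_image_le hs _
      _ = _ := by
          rw [ENNReal.tsum_mul_left, ← measure_iUnion (hUd n) (hUm n), hUc]
  have hlim : ∫⁻ y, liminf (fun n => g n y) atTop ∂μH[s] ≠ ∞ := by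
    refine ((lintegral_liminf_le hgm).trans
      ((liminf_le_liminf (Eventually.of_forall hgi)).trans (liminf_const _).le)).trans_lt ?_ |>.ne
    exact ENNReal.mul_lt_top (ENNReal.rpow_lt_top_of_nonneg hs ENNReal.coe_ne_top) hfin
  filter_upwards [ae_lt_top (Measurable.liminf hgm) hlim] with y hy
  by_contra hinf
  refine hy.ne (ENNReal.eq_top_of_forall_nnreal_le fun c => ?_)
  obtain ⟨M, hM⟩ := exists_nat_ge c
  obtain ⟨F, hF, hFc⟩ := Set.Infinite.exists_subset_card_eq hinf M
  have hsep : ∀ᶠ n : ℕ in atTop, ∀ a ∈ F, ∀ b ∈ F, a ≠ b → 1 / ((n : ℝ) + 1) < dist a b := by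
    rw [Filter.eventually_all_finset]
    intro a _
    rw [Filter.eventually_all_finset]
    intro b _
    by_cases hab : a = b
    · simp [hab]
    · filter_upwards [(tendsto_one_div_add_atTop_nhds_zero_nat (𝕜 := ℝ)).eventually
        (gt_mem_nhds (dist_pos.2 hab))] with n hn _ using hn
  refine le_liminf_of_le (by isBoundedDefault) ?_
  filter_upwards [hsep] with n hn
  have hidx : ∀ a, ∃ i, a ∈ U n i := fun a => mem_iUnion.1 (hUc n ▸ mem_univ a)
  choose φ hφ using hidx
  have hinj : Set.InjOn φ F := by
    intro a ha b hb hab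
    by_contra hne
    exact absurd (hUs n (φ a) a (hφ a) b (hab ▸ hφ b)) (hn a ha b hb hne).le.not_gt
  calc (c : ℝ≥0∞) ≤ (M : ℝ≥0∞) := by exact_mod_cast hM
    _ = ∑ i ∈ F.image φ, 1 := by
      rw [Finset.sum_const, Finset.card_image_of_injOn hinj, hFc]; simp
    _ ≤ ∑ i ∈ F.image φ, (toMeasurable μH[s] (f '' U n i)).indicator (fun _ => 1) y := by
      refine Finset.sum_le_sum fun i hi => ?_
      obtain ⟨a, ha, rfl⟩ := Finset.mem_image.1 hi
      rw [indicator_of_mem]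
      exact subset_toMeasurable _ _ ⟨a, hφ a, hF ha⟩
    _ ≤ g n y := ENNReal.sum_le_tsum _

/-! ### Uniform form of the density condition, and null preimages. -/

/-- The points `x` such that, for all radii `r < 1 / (n + 1)`, the image of `B(x, r)` misses at
most measure `q * r ^ s` of the ball `B(f x, p * r)`, while the smaller ball `B(f x, p' * r)` has
measure at least `q' * r ^ s`. -/
def imageDensityPoints {X Y : Type*} [MetricSpace X] [MetricSpace Y] [MeasurableSpace Y]
    [BorelSpace Y] (s : ℝ) (f : X → Y) (p p' : ℝ) (q q' : ℝ≥0∞) (n : ℕ) : Set X :=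
  {x | ∀ r : ℝ, 0 < r → r < 1 / ((n : ℝ) + 1) →
    μH[s] (Metric.ball (f x) (p * r) \ f '' Metric.ball x r) ≤ q * ENNReal.ofReal r ^ s ∧
    q' * ENNReal.ofReal r ^ s ≤ μH[s] (Metric.ball (f x) (p' * r))}

/-- The density condition at `x`, expressed with rational parameters. -/
theorem exists_mem_imageDensityPoints {X Y : Type*} [MetricSpace X] [MetricSpace Y]
    [MeasurableSpace Y] [BorelSpace Y] {s : ℝ} (hs : 0 < s) {f : X → Y} {x : X} {l : ℝ}
    (hl : 0 < l)
    (h : upperMissedDensity s f x l < 1 / 2 * lowerHausdorffDensity s univ (f x)) :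
    ∃ (p p' q q' : ℚ) (n : ℕ), 0 < p' ∧ p' < p ∧
      2 * ENNReal.ofReal q < ENNReal.ofReal q' ∧
      x ∈ imageDensityPoints s f p p' (ENNReal.ofReal q) (ENNReal.ofReal q') n := by
  have hpow : ∀ a r : ℝ, 0 < a →
      ENNReal.ofReal (a * r) ^ s = ENNReal.ofReal a ^ s * ENNReal.ofReal r ^ s := fun a r ha => by
    rw [ENNReal.ofReal_mul ha.le, ENNReal.mul_rpow_of_nonneg _ _ hs.le]
  obtain ⟨a, ha1, ha2⟩ := exists_between h
  have ha2' : 2 * a < lowerHausdorffDensity s univ (f x) := by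
    rw [one_div] at ha2
    have := ENNReal.mul_lt_mul_right (a := 2) (by simp) (by simp) ha2
    rwa [← mul_assoc, ENNReal.mul_inv_cancel (by simp) (by simp), one_mul] at this
  obtain ⟨b, hb1, hb2⟩ := exists_between ha2'
  have hA : ∀ᶠ r in 𝓝[>] (0 : ℝ), μH[s] (Metric.ball (f x) (l * r) \ f '' Metric.ball x r) ≤
      a * ENNReal.ofReal (2 * l) ^ s * ENNReal.ofReal r ^ s := by
    filter_upwards [eventually_lt_of_limsup_lt ha1, self_mem_nhdsWithin] with r hr hr0
    rw [mul_assoc, ← hpow _ _ (by positivity)]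
    rw [mem_Ioi] at hr0
    refine (ENNReal.div_le_iff ?_ ?_).1 hr.le
    · have : 0 < 2 * l * r := by positivity
      simpa [ENNReal.rpow_eq_zero_iff, hs, hs.le] using this
    · exact ENNReal.rpow_ne_top_of_nonneg hs.le ENNReal.ofReal_ne_top
  have hB : ∀ᶠ r in 𝓝[>] (0 : ℝ), b * ENNReal.ofReal 2 ^ s * ENNReal.ofReal r ^ s ≤
      μH[s] (Metric.ball (f x) r) := by
    filter_upwards [eventually_lt_of_lt_liminf hb2, self_mem_nhdsWithin] with r hr hr0
    rw [inter_univ] at hr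
    rw [mul_assoc, ← hpow _ _ (by positivity)]
    rw [mem_Ioi] at hr0
    refine (ENNReal.le_div_iff_mul_le (Or.inl ?_)
      (Or.inl (ENNReal.rpow_ne_top_of_nonneg hs.le ENNReal.ofReal_ne_top))).1 hr.le
    simpa [ENNReal.rpow_eq_zero_iff, hs, hs.le] using hr0
  have hb : b ≠ ∞ := hb2.ne_top
  have hC0 : ENNReal.ofReal (2 * l) ^ s ≠ 0 := by
    simpa [ENNReal.rpow_eq_zero_iff, hs, hs.le] using hl
  have hC1 : ENNReal.ofReal (2 * l) ^ s ≠ ∞ := ENNReal.rpow_ne_top_of_nonneg hs.le ENNReal.ofReal_ne_top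
  obtain ⟨q, -, hq1, hq2⟩ : ∃ q : ℚ, 0 ≤ q ∧ a * ENNReal.ofReal (2 * l) ^ s < ENNReal.ofReal q ∧
      ENNReal.ofReal q < b * ENNReal.ofReal (2 * l) ^ s / 2 := by
    refine ENNReal.lt_iff_exists_rat_btwn.1 ?_
    rw [ENNReal.lt_div_iff_mul_lt (by simp) (by simp), mul_right_comm, mul_comm a]
    exact ENNReal.mul_lt_mul_left hC0 hC1 hb1
  rw [ENNReal.lt_div_iff_mul_lt (by simp) (by simp), mul_comm _ (2 : ℝ≥0∞)] at hq2
  have hcont : Continuous fun z : ℝ => b * ENNReal.ofReal 2 ^ s * ENNReal.ofReal z ^ s :=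
    (ENNReal.continuous_const_mul (ENNReal.mul_ne_top hb
      (ENNReal.rpow_ne_top_of_nonneg hs.le ENNReal.ofReal_ne_top))).comp
      (ENNReal.continuous_rpow_const.comp ENNReal.continuous_ofReal)
  -- By continuity the strict inequality survives shrinking the radius factor slightly below `l`;
  -- this leaves room for `p' < p < l`.
  have hev : ∀ᶠ z in 𝓝[<] l, 2 * ENNReal.ofReal q <
      b * ENNReal.ofReal 2 ^ s * ENNReal.ofReal z ^ s := by
    refine nhdsWithin_le_nhds (hcont.tendsto l |>.eventually (lt_mem_nhds ?_))
    rwa [mul_assoc, ← hpow _ _ two_pos]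
  obtain ⟨z, hz, hzs⟩ := (mem_nhdsLT_iff_exists_Ioo_subset' hl).1
    (inter_mem hev (Ioo_mem_nhdsLT hl))
  obtain ⟨p, hp1, hp2⟩ := exists_rat_btwn (show z < l from hz)
  obtain ⟨p', hp1', hp2'⟩ := exists_rat_btwn (show z < (p : ℝ) from hp1)
  obtain ⟨hp3, hp4, -⟩ := hzs ⟨hp1', hp2'.trans hp2⟩
  obtain ⟨q', -, hq1', hq2'⟩ := ENNReal.lt_iff_exists_rat_btwn.1 hp3
  have hB' : ∀ᶠ r in 𝓝[>] (0 : ℝ), b * ENNReal.ofReal 2 ^ s * ENNReal.ofReal (p' * r) ^ s ≤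
      μH[s] (Metric.ball (f x) (p' * r)) := by
    have : Tendsto (fun r : ℝ => (p' : ℝ) * r) (𝓝[>] 0) (𝓝[>] 0) := by
      refine tendsto_nhdsWithin_iff.2 ⟨?_, ?_⟩
      · have : Tendsto (fun r : ℝ => (p' : ℝ) * r) (𝓝 0) (𝓝 (p' * 0)) :=
          tendsto_id.const_mul _
        rw [mul_zero] at this
        exact this.mono_left nhdsWithin_le_nhds
      · filter_upwards [self_mem_nhdsWithin] with r hr using mul_pos hp4 hr
    exact this.eventually hB
  obtain ⟨δ, hδ, hδs⟩ := (mem_nhdsGT_iff_exists_Ioo_subset' (show (0 : ℝ) < 1 by simp)).1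
    (inter_mem hA hB')
  obtain ⟨n, hn⟩ := exists_nat_one_div_lt (show (0 : ℝ) < δ from hδ)
  refine ⟨p, p', q, q', n, by exact_mod_cast hp4, by exact_mod_cast hp2', hq1', fun r hr hrn => ?_⟩
  obtain ⟨h1, h2⟩ := hδs ⟨hr, hrn.trans hn⟩
  constructor
  · refine le_trans (measure_mono (sdiff_subset_sdiff_left (Metric.ball_subset_ball ?_)))
      (h1.trans ?_)
    · gcongr
    · gcongr
  · refine le_trans ?_ h2
    rw [hpow _ _ hp4, ← mul_assoc]
    gcongr
    exact hq2'.le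

/-- Under the density condition, null sets have null preimages. -/
theorem hausdorffMeasure_preimage_eq_zero {X Y : Type*} [MetricSpace X]
    [SecondCountableTopology X] [MeasurableSpace X] [BorelSpace X] [MetricSpace Y]
    [MeasurableSpace Y] [BorelSpace Y] {s : ℝ} (hs : 0 < s) {f : X → Y} {L : ℝ≥0}
    (hf : LipschitzWith L f) (hfin : μH[s] (univ : Set X) < ∞)
    (hd : ∀ᵐ x ∂(μH[s] : Measure X), ∃ (p p' q q' : ℚ) (n : ℕ), 0 < p' ∧ p' < p ∧
      2 * ENNReal.ofReal q < ENNReal.ofReal q' ∧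
      x ∈ imageDensityPoints s f p p' (ENNReal.ofReal q) (ENNReal.ofReal q') n)
    {Z : Set Y} (hZ : μH[s] Z = 0) : μH[s] (f ⁻¹' Z) = 0 := by
  set W := toMeasurable μH[s] Z
  have hW : μH[s] W = 0 := by rw [measure_toMeasurable, hZ]
  have hWm : MeasurableSet (f ⁻¹' W) := hf.continuous.measurable (measurableSet_toMeasurable _ _)
  refine measure_mono_null (t := f ⁻¹' W) (preimage_mono (subset_toMeasurable μH[s] Z)) ?_
  rw [measure_eq_zero_iff_ae_notMem]
  filter_upwards [hd, ae_eventually_hausdorffMeasure_ball_inter_le hs hfin hWm.compl]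
    with x hx hdens hxW
  obtain ⟨p, p', q, q', n, hp', hp, hq, hx⟩ := hx
  have hq1 : ENNReal.ofReal q < ENNReal.ofReal q' :=
    lt_of_le_of_lt (by rw [two_mul]; exact le_self_add) hq
  have hL : (L : ℝ≥0∞) ^ s ≠ ∞ := ENNReal.rpow_ne_top_of_nonneg hs.le ENNReal.coe_ne_top
  -- At a density point of `f ⁻¹' W`, the ball around `f x` consists of the missed part, the image
  -- of a sparse set, and part of the null set `W`: too little to reach `q'`.
  obtain ⟨k, hk⟩ := ENNReal.exists_nat_add_mul_inv_lt hq1 hL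
  set τ := ((k : ℝ≥0∞) + 1)⁻¹ with hτ
  have hn : ∀ᶠ r in 𝓝[>] (0 : ℝ), 0 < r ∧ r < 1 / ((n : ℝ) + 1) :=
    Ioo_mem_nhdsGT (by positivity)
  obtain ⟨r, hr, hr0, hrn⟩ := ((hdens (by simpa using hxW) τ (by simp [hτ])).and hn).exists
  obtain ⟨h1, h2⟩ := hx r hr0 hrn
  have hr1 : ENNReal.ofReal r ^ s ≠ 0 := by
    simpa [ENNReal.rpow_eq_zero_iff, hs, hs.le] using hr0
  have hr2 : ENNReal.ofReal r ^ s ≠ ∞ := ENNReal.rpow_ne_top_of_nonneg hs.le ENNReal.ofReal_ne_top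
  refine absurd (ENNReal.mul_lt_mul_left hr1 hr2 hk) (not_lt.2 ?_)
  calc ENNReal.ofReal q' * ENNReal.ofReal r ^ s
      ≤ μH[s] (Metric.ball (f x) (p' * r)) := h2
    _ ≤ μH[s] ((Metric.ball (f x) (p * r) \ f '' Metric.ball x r) ∪
          (f '' (Metric.ball x r ∩ (f ⁻¹' W)ᶜ) ∪ W)) := by
        refine measure_mono fun y hy => ?_
        by_cases hyi : y ∈ f '' Metric.ball x r
        · obtain ⟨z, hz, rfl⟩ := hyi
          by_cases hzW : f z ∈ W
          · exact Or.inr (Or.inr hzW)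
          · exact Or.inr (Or.inl ⟨z, ⟨hz, hzW⟩, rfl⟩)
        · refine Or.inl ⟨Metric.ball_subset_ball ?_ hy, hyi⟩
          gcongr
    _ ≤ ENNReal.ofReal q * ENNReal.ofReal r ^ s +
          ((L : ℝ≥0∞) ^ s * (τ * ENNReal.ofReal r ^ s) + 0) := by
        refine (measure_union_le _ _).trans (add_le_add h1 ((measure_union_le _ _).trans
          (add_le_add ((hf.hausdorffMeasure_image_le hs.le _).trans ?_) hW.le)))
        gcongr
    _ = (ENNReal.ofReal q + (L : ℝ≥0∞) ^ s * τ) * ENNReal.ofReal r ^ s := by ring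

/-! ### Decomposition into injective pieces. -/

/-- If almost every point lies in a finite fibre of the continuous map `f`, then almost all of the
space is covered by countably many Borel sets on which `f` is injective. -/
theorem exists_injOn_cover_of_ae_finite_fibre {X Y : Type*} [MetricSpace X] [CompleteSpace X]
    [SecondCountableTopology X] [MeasurableSpace X] [BorelSpace X] [TopologicalSpace Y] [T2Space Y]
    (μ : Measure X) [IsFiniteMeasure μ] {f : X → Y} (hf : Continuous f)
    (hfib : ∀ᵐ x ∂μ, (f ⁻¹' {f x}).Finite) :
    ∃ E : ℕ × ℕ × ℕ → Set X, (∀ i, MeasurableSet (E i)) ∧ (∀ i, InjOn f (E i)) ∧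
      ∀ᵐ x ∂μ, ∃ i, x ∈ E i := by
  have hK : ∀ k : ℕ, ∃ K : Set X, IsCompact K ∧ μ Kᶜ < ((k : ℝ≥0∞) + 1)⁻¹ := fun k => by
    obtain ⟨K, -, hK, hlt⟩ := MeasurableSet.univ.exists_isCompact_sdiff_lt (μ := μ)
      (measure_ne_top μ univ) (ε := ((k : ℝ≥0∞) + 1)⁻¹) (by simp)
    exact ⟨K, hK, by rwa [← compl_eq_univ_sdiff] at hlt⟩
  choose K hKc hKlt using hK
  have hKae : ∀ᵐ x ∂μ, ∃ k, x ∈ K k := by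
    rw [ae_iff]
    refine le_antisymm (ge_of_tendsto' ENNReal.tendsto_inv_nat_add_one_nhds_zero fun k => ?_)
      zero_le
    refine (measure_mono (t := (K k)ᶜ) ?_).trans (hKlt k).le
    exact fun x hx hxk => hx ⟨k, hxk⟩
  have hU := fun n : ℕ =>
    exists_measurable_partition_dist_lt X (Nat.one_div_pos_of_nat (α := ℝ) (n := n))
  choose U hUm hUd hUc hUs using hU
  -- `D k n` collects the points of `K k` with a different point of `K k` in the same fibre within
  -- `1 / (n + 1)`. The lower bound `1 / (m + 1)` makes each set in the union the projection of a
  -- compact set, hence Borel.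
  let D : ℕ → ℕ → Set X := fun k n => ⋃ m : ℕ, Prod.fst '' ((K k ×ˢ K k) ∩
    {z : X × X | f z.1 = f z.2 ∧ 1 / ((m : ℝ) + 1) ≤ dist z.1 z.2 ∧
      dist z.1 z.2 ≤ 1 / ((n : ℝ) + 1)})
  have hD : ∀ k n, MeasurableSet (D k n) := by
    refine fun k n => MeasurableSet.iUnion fun m => IsCompact.measurableSet ?_
    refine IsCompact.image (((hKc k).prod (hKc k)).inter_right ?_) continuous_fst
    exact (isClosed_eq (hf.comp continuous_fst) (hf.comp continuous_snd)).inter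
      ((isClosed_le continuous_const continuous_dist).inter
        (isClosed_le continuous_dist continuous_const))
  refine ⟨fun i => (K i.1 \ D i.1 i.2.1) ∩ U i.2.1 i.2.2, fun i => ?_, fun i x hx y hy hxy => ?_, ?_⟩
  · exact ((hKc _).measurableSet.diff (hD _ _)).inter (hUm _ _)
  · by_contra hne
    obtain ⟨m, hm⟩ := exists_nat_one_div_lt (dist_pos.2 hne)
    exact hx.1.2 (mem_iUnion.2 ⟨m, (x, y), ⟨⟨hx.1.1, hy.1.1⟩, hxy, hm.le,
      (hUs _ _ x hx.2 y hy.2).le⟩, rfl⟩)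
  · filter_upwards [hfib, hKae] with x hx ⟨k, hk⟩
    have hcl : IsClosed (f ⁻¹' {f x} \ {x}) := (hx.subset sdiff_subset).isClosed
    obtain ⟨ε, hε, hεs⟩ := Metric.isOpen_iff.1 hcl.isOpen_compl x (by simp)
    obtain ⟨n, hn⟩ := exists_nat_one_div_lt hε
    obtain ⟨j, hj⟩ := mem_iUnion.1 ((hUc n).symm ▸ mem_univ x)
    refine ⟨(k, n, j), ⟨hk, fun hxD => ?_⟩, hj⟩
    obtain ⟨m, ⟨x', y⟩, ⟨-, hfy, hm, hny⟩, rfl⟩ := mem_iUnion.1 hxD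
    refine hεs (show y ∈ Metric.ball x' ε from ?_) ⟨hfy.symm, ?_⟩
    · rw [Metric.mem_ball']
      exact hny.trans_lt hn
    · rintro rfl
      have : (0 : ℝ) < 1 / ((m : ℝ) + 1) := by positivity
      simp only [dist_self] at hm
      linarith

/-! ### Antilipschitz estimate on injective pieces. -/

/-- If `f` is injective on `E`, `E` has small relative complement in the balls of radius
`r = d(x, x') / 2` around two of its points `x`, `x'`, and the images of both balls nearly fill
more than half of the respective target balls, then `f x` and `f x'` cannot be close. -/
theorem mul_le_dist_of_mem_imageDensityPoints {X Y : Type*} [MetricSpace X] [MeasurableSpace X]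
    [BorelSpace X] [MetricSpace Y] [MeasurableSpace Y] [BorelSpace Y] {s : ℝ} (hs : 0 < s)
    {f : X → Y} {L : ℝ≥0} (hf : LipschitzWith L f) {E : Set X} (hE : InjOn f E) {p p' : ℝ}
    {q q' τ : ℝ≥0∞} {n : ℕ} (hq : 2 * q + 2 * (L : ℝ≥0∞) ^ s * τ < q') {x x' : X} {r : ℝ}
    (hr : 0 < r) (hrn : r < 1 / ((n : ℝ) + 1)) (hrd : 2 * r ≤ dist x x')
    (hx : x ∈ imageDensityPoints s f p p' q q' n) (hx' : x' ∈ imageDensityPoints s f p p' q q' n)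
    (hτ : μH[s] (Metric.ball x r ∩ Eᶜ) ≤ τ * ENNReal.ofReal r ^ s)
    (hτ' : μH[s] (Metric.ball x' r ∩ Eᶜ) ≤ τ * ENNReal.ofReal r ^ s) :
    (p - p') * r ≤ dist (f x) (f x') := by
  by_contra! hlt
  have hr1 : ENNReal.ofReal r ^ s ≠ 0 := by
    simpa [ENNReal.rpow_eq_zero_iff, hs, hs.le] using hr
  have hr2 : ENNReal.ofReal r ^ s ≠ ∞ :=
    ENNReal.rpow_ne_top_of_nonneg hs.le ENNReal.ofReal_ne_top
  refine absurd (ENNReal.mul_lt_mul_left hr1 hr2 hq) (not_lt.2 ?_)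
  have him : ∀ z : X, μH[s] (Metric.ball z r ∩ Eᶜ) ≤ τ * ENNReal.ofReal r ^ s →
      μH[s] (f '' (Metric.ball z r ∩ Eᶜ)) ≤ (L : ℝ≥0∞) ^ s * (τ * ENNReal.ofReal r ^ s) :=
    fun z hz => (hf.hausdorffMeasure_image_le hs.le _).trans (by gcongr)
  calc q' * ENNReal.ofReal r ^ s
      ≤ μH[s] (Metric.ball (f x) (p' * r)) := (hx r hr hrn).2
    -- The gap `p - p'` puts the small ball inside both large ones. A point hit by both images has a
    -- preimage in each of two disjoint balls, so by injectivity one of them lies outside `E`.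
    _ ≤ μH[s] (((Metric.ball (f x) (p * r) \ f '' Metric.ball x r) ∪
          (Metric.ball (f x') (p * r) \ f '' Metric.ball x' r)) ∪
          (f '' (Metric.ball x r ∩ Eᶜ) ∪ f '' (Metric.ball x' r ∩ Eᶜ))) := by
        refine measure_mono fun y hy => ?_
        rw [Metric.mem_ball] at hy
        by_cases h1 : y ∈ f '' Metric.ball x r
        · by_cases h2 : y ∈ f '' Metric.ball x' r
          · refine Or.inr ?_
            obtain ⟨z, hz, rfl⟩ := h1
            obtain ⟨z', hz', hzz⟩ := h2
            by_cases hzE : z ∈ E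
            · by_cases hzE' : z' ∈ E
              · have := hE hzE' hzE hzz
                subst this
                rw [Metric.mem_ball] at hz hz'
                linarith [dist_triangle_left x x' z']
              · exact Or.inr ⟨z', ⟨hz', hzE'⟩, hzz⟩
            · exact Or.inl ⟨z, ⟨hz, hzE⟩, rfl⟩
          · refine Or.inl (Or.inr ⟨?_, h2⟩)
            rw [Metric.mem_ball]
            linarith [dist_triangle y (f x) (f x')]
        · refine Or.inl (Or.inl ⟨?_, h1⟩)
          rw [Metric.mem_ball]
          linarith [dist_nonneg (x := f x) (y := f x')]
    _ ≤ (q * ENNReal.ofReal r ^ s + q * ENNReal.ofReal r ^ s) +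
          ((L : ℝ≥0∞) ^ s * (τ * ENNReal.ofReal r ^ s) +
            (L : ℝ≥0∞) ^ s * (τ * ENNReal.ofReal r ^ s)) :=
        (measure_union_le _ _).trans (add_le_add
          ((measure_union_le _ _).trans (add_le_add (hx r hr hrn).1 (hx' r hr hrn).1))
          ((measure_union_le _ _).trans (add_le_add (him x hτ) (him x' hτ'))))
    _ = (2 * q + 2 * (L : ℝ≥0∞) ^ s * τ) * ENNReal.ofReal r ^ s := by ring

/-- Under the density condition, a Borel set `E` on which `f` is injective is covered, up to a null
set, by countably many sets on which `f` is antilipschitz. -/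
theorem exists_antilipschitz_cover_of_injOn {X Y : Type*} [MetricSpace X]
    [SecondCountableTopology X] [MeasurableSpace X] [BorelSpace X] [MetricSpace Y]
    [MeasurableSpace Y] [BorelSpace Y] {s : ℝ} (hs : 0 < s) {f : X → Y} {L : ℝ≥0}
    (hf : LipschitzWith L f) (hfin : μH[s] (univ : Set X) < ∞)
    (hd : ∀ᵐ x ∂(μH[s] : Measure X), ∃ (p p' q q' : ℚ) (n : ℕ), 0 < p' ∧ p' < p ∧
      2 * ENNReal.ofReal q < ENNReal.ofReal q' ∧
      x ∈ imageDensityPoints s f p p' (ENNReal.ofReal q) (ENNReal.ofReal q') n)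
    {E : Set X} (hEm : MeasurableSet E) (hE : InjOn f E) :
    ∃ F : ((ℚ × ℚ) × (ℚ × ℚ)) × (ℕ × ℕ × ℕ × ℕ) → Set X,
      (∀ i, ∃ K : ℝ≥0, ∀ x ∈ F i, ∀ y ∈ F i, dist x y ≤ K * dist (f x) (f y)) ∧
      ∀ᵐ x ∂(μH[s] : Measure X), x ∈ E → ∃ i, x ∈ F i := by
  have hU := fun n : ℕ =>
    exists_measurable_partition_dist_lt X (Nat.one_div_pos_of_nat (α := ℝ) (n := n))
  choose U hUm hUd hUc hUs using hU
  refine ⟨fun ((((p, p'), (q, q')), (n, k, m, j))) => {x | x ∈ E ∧ p' < p ∧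
    2 * ENNReal.ofReal q + 2 * (L : ℝ≥0∞) ^ s * ((k : ℝ≥0∞) + 1)⁻¹ < ENNReal.ofReal q' ∧
    x ∈ imageDensityPoints s f p p' (ENNReal.ofReal q) (ENNReal.ofReal q') n ∧
    (∀ r : ℝ, 0 < r → r < 1 / ((m : ℝ) + 1) →
      μH[s] (Metric.ball x r ∩ Eᶜ) ≤ ((k : ℝ≥0∞) + 1)⁻¹ * ENNReal.ofReal r ^ s) ∧
    x ∈ U (max n m) j}, ?_, ?_⟩
  · rintro ⟨⟨⟨p, p'⟩, q, q'⟩, n, k, m, j⟩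
    -- The estimate is used with `r = dist x y / 2`, whence the 2; the mesh of `U (max n m)` keeps
    -- `r` below both thresholds.
    refine ⟨Real.toNNReal (2 / (p - p')), ?_⟩
    rintro x ⟨-, hp, hq, hx, hxm, hxU⟩ y ⟨-, -, -, hy, hym, hyU⟩
    rcases eq_or_ne x y with rfl | hne
    · simp
    have hp0 : (0 : ℝ) < p - p' := sub_pos.2 (by exact_mod_cast hp)
    have hd0 : 0 < dist x y := dist_pos.2 hne
    have hdN := hUs _ _ x hxU y hyU
    have hdn : dist x y / 2 < 1 / ((n : ℝ) + 1) := (half_lt_self hd0).trans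
      (hdN.trans_le (Nat.one_div_le_one_div (le_max_left n m)))
    have hdm : dist x y / 2 < 1 / ((m : ℝ) + 1) := (half_lt_self hd0).trans
      (hdN.trans_le (Nat.one_div_le_one_div (le_max_right n m)))
    have key := mul_le_dist_of_mem_imageDensityPoints hs hf hE hq (half_pos hd0) hdn
      (by linarith) hx hy (hxm _ (half_pos hd0) hdm) (hym _ (half_pos hd0) hdm)
    rw [Real.coe_toNNReal _ (by positivity), div_mul_eq_mul_div, le_div_iff₀ hp0]
    linarith
  · filter_upwards [hd, ae_eventually_hausdorffMeasure_ball_inter_le hs hfin hEm.compl]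
      with x ⟨p, p', q, q', n, _, hp, hq, hx⟩ hdens hxE
    obtain ⟨k, hk⟩ := ENNReal.exists_nat_add_mul_inv_lt hq (c := 2 * (L : ℝ≥0∞) ^ s)
      (ENNReal.mul_ne_top (by simp) (ENNReal.rpow_ne_top_of_nonneg hs.le ENNReal.coe_ne_top))
    obtain ⟨δ, hδ, hδs⟩ := (mem_nhdsGT_iff_exists_Ioo_subset' (show (0 : ℝ) < 1 by simp)).1
      (hdens (by simpa using hxE) ((k : ℝ≥0∞) + 1)⁻¹ (by simp))
    obtain ⟨m, hm⟩ := exists_nat_one_div_lt (show (0 : ℝ) < δ from hδ)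
    obtain ⟨j, hj⟩ := mem_iUnion.1 ((hUc (max n m)).symm ▸ mem_univ x)
    exact ⟨((⟨p, p'⟩, q, q'), n, k, m, j), hxE, hp, hk, hx,
      fun r hr hrm => hδs ⟨hr, hrm.trans hm⟩, hj⟩

/-! ### Closures and assembly. -/

/-- Passing to closures yields Borel pieces without any measurability of `imageDensityPoints`. -/
theorem dist_le_mul_dist_closure {X Y : Type*} [MetricSpace X] [MetricSpace Y] {f : X → Y}
    (hf : Continuous f) {S : Set X} {K : ℝ} (h : ∀ x ∈ S, ∀ y ∈ S, dist x y ≤ K * dist (f x) (f y)) :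
    ∀ x ∈ closure S, ∀ y ∈ closure S, dist x y ≤ K * dist (f x) (f y) := by
  have hcl : IsClosed {z : X × X | dist z.1 z.2 ≤ K * dist (f z.1) (f z.2)} :=
    isClosed_le continuous_dist (by fun_prop)
  intro x hx y hy
  have hsub : S ×ˢ S ⊆ {z : X × X | dist z.1 z.2 ≤ K * dist (f z.1) (f z.2)} :=
    fun z hz => h z.1 hz.1 z.2 hz.2
  exact closure_minimal hsub hcl (closure_prod_eq (s := S) (t := S) ▸ mk_mem_prod hx hy)

theorem mainTheorem1 {X Y : Type*}
    [MetricSpace X] [CompleteSpace X] [MeasurableSpace X] [BorelSpace X]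
    [MetricSpace Y] [CompleteSpace Y] [MeasurableSpace Y] [BorelSpace Y]
    (s : ℝ) (hs : 0 < s) (f : X → Y) (hf : ∃ L : ℝ≥0, LipschitzWith L f)
    (hfin : μH[s] (univ : Set X) < ∞)
    (hdens : ∀ᵐ x ∂(μH[s] : Measure X), ∃ l : ℝ, 0 < l ∧ l ≤ 1 ∧
      upperMissedDensity s f x l < 1 / 2 * lowerHausdorffDensity s univ (f x)) :
    ∃ (N : Set X) (E : ℕ → Set X),
      MeasurableSet N ∧ (∀ i, MeasurableSet (E i)) ∧
      N ∪ ⋃ i, E i = univ ∧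
      (∀ i, Disjoint N (E i)) ∧ (∀ i j, i ≠ j → Disjoint (E i) (E j)) ∧
      μH[s] N = 0 ∧
      ∀ i, IsBiLipschitz ((E i).domRestrict f) := by
  obtain ⟨L, hf⟩ := hf
  have := secondCountableTopology_of_hausdorffMeasure_univ_lt_top hfin
  have : IsFiniteMeasure (μH[s] : Measure X) := ⟨hfin⟩
  have hd : ∀ᵐ x ∂(μH[s] : Measure X), ∃ (p p' q q' : ℚ) (n : ℕ), 0 < p' ∧ p' < p ∧
      2 * ENNReal.ofReal q < ENNReal.ofReal q' ∧
      x ∈ imageDensityPoints s f p p' (ENNReal.ofReal q) (ENNReal.ofReal q') n :=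
    hdens.mono fun x ⟨l, hl, _, h⟩ => exists_mem_imageDensityPoints hs hl h
  -- The exceptional null set of infinite fibres lives in `Y`; null preimages carry it back to `X`.
  have hfib : ∀ᵐ x ∂(μH[s] : Measure X), (f ⁻¹' {f x}).Finite :=
    hausdorffMeasure_preimage_eq_zero hs hf hfin hd
      (ae_iff.1 (hf.ae_finite_preimage_singleton hs.le hfin))
  obtain ⟨E, hEm, hEinj, hEae⟩ := exists_injOn_cover_of_ae_finite_fibre μH[s] hf.continuous hfib
  choose F hF hFae using fun i =>
    exists_antilipschitz_cover_of_injOn hs hf hfin hd (hEm i) (hEinj i)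
  obtain ⟨g, hg⟩ := exists_surjective_nat
    ((ℕ × ℕ × ℕ) × (((ℚ × ℚ) × (ℚ × ℚ)) × (ℕ × ℕ × ℕ × ℕ)))
  let C : ℕ → Set X := fun n => closure (F (g n).1 (g n).2)
  have hCm : ∀ n, MeasurableSet (C n) := fun n => isClosed_closure.measurableSet
  refine ⟨(⋃ n, C n)ᶜ, disjointed C, (MeasurableSet.iUnion hCm).compl,
    fun i => MeasurableSet.disjointed hCm i, ?_, fun i => ?_,
    fun i j hij => disjoint_disjointed C hij, ?_, fun i => ?_⟩
  · rw [iUnion_disjointed, compl_union_self]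
  · exact disjoint_compl_left_iff_subset.2
      ((disjointed_subset C i).trans (subset_iUnion C i))
  · rw [measure_eq_zero_iff_ae_notMem]
    filter_upwards [hEae, ae_all_iff.2 hFae] with x ⟨i, hi⟩ hx
    obtain ⟨a, ha⟩ := hx i hi
    obtain ⟨n, hn⟩ := hg (i, a)
    refine notMem_compl_iff.2 (mem_iUnion.2 ⟨n, subset_closure ?_⟩)
    rwa [hn]
  · obtain ⟨K, hK⟩ := hF (g i).1 (g i).2
    have hanti : AntilipschitzWith K ((disjointed C i).domRestrict f) :=
      AntilipschitzWith.of_le_mul_dist fun x y => dist_le_mul_dist_closure hf.continuous hK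
        x.1 (disjointed_subset C i x.2) y.1 (disjointed_subset C i y.2)
    exact ⟨hanti.injective, ⟨L, fun x y => hf x.1 y.1⟩, K, hanti⟩
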